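/- Fix an infinite set of variables and a set of predicates, each with a finite arity. Formulas are built by $\phi ::= P(y_1,\dots,y_n)\mid\neg\phi\mid\phi\wedge\phi\mid[\mathsf K]\phi\mid[\mathsf K_{wh}]^x\phi$, where $[\mathsf K_{wh}]^x$ binds $x$; put $\langle\mathsf K\rangle\phi:=\neg[\mathsf K]\neg\phi$ and $[\mathsf B]\phi:=\langle\mathsf K\rangle[\mathsf K]\phi$. Whenever $\phi[y/x]$ (replace the free occurrences of $x$ by $y$) is written, $y$ is assumed admissible for $x$ in $\phi$, i.e. no free occurrence of $x$ lies in the scope of an operator $[\mathsf K_{wh}]^y$. The symbol $[\mathsf K_{wh}]$ stands for one of four operators: mention-some true belief $[\mathsf{tB}^{MS}]$, i.e. $\exists x([\mathsf B]\phi\wedge\phi)$; $[\mathsf{tB}^{MS}_{FS}]$, i.e. $\exists x([\mathsf B]\phi\wedge\phi)\wedge\forall x([\mathsf B]\phi\to\phi)$; mention-some knowledge $[\mathsf{K}^{MS}]$, i.e. $\exists x[\mathsf K]\phi$; and $[\mathsf{K}^{MS}_{FS}]$, i.e. $\exists x[\mathsf K]\phi\wedge\forall x([\mathsf B]\phi\to\phi)$.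 For each of them let $\mathbf{S4.2}^{[\mathsf K_{wh}]}$ be the set of theorems of the Hilbert system consisting of all propositional tautologies, modus ponens, necessitation for $[\mathsf K]$, the axioms $[\mathsf K](\phi\to\psi)\to([\mathsf K]\phi\to[\mathsf K]\psi)$, $[\mathsf K]\phi\to\phi$, $[\mathsf K]\phi\to[\mathsf K][\mathsf K]\phi$, $\langle\mathsf K\rangle[\mathsf K]\phi\to[\mathsf K]\langle\mathsf K\rangle\phi$, together with the following axioms and rules. Here, for a fixed choice of $n\ge 0$ and formulas $\psi_0,\dots,\psi_n$ in which $x$ is not free, $C(\chi)$ denotes $\psi_0\to[\mathsf K](\psi_1\to\cdots[\mathsf K](\psi_n\to\chi)\cdots)$. - $[\mathsf{tB}^{MS}]$: the axiom $([\mathsf B]\phi\wedge\phi)[y/x]\to[\mathsf K_{wh}]^x\phi$, and the rule from $C(\neg([\mathsf B]\phi\wedge\phi))$ infer $C(\neg[\mathsf K_{wh}]^x\phi)$. - $[\mathsf{tB}^{MS}_{FS}]$: the axioms $[\mathsf K_{wh}]^x\phi\to([\mathsf B]\phi\to\phi)[y/x]$ and $[\mathsf B]\phi[y/x]\to[\mathsf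 B][\mathsf K_{wh}]^x\phi$, the rule from $C(\neg([\mathsf B]\phi\wedge\phi))$ infer $C(\neg[\mathsf K_{wh}]^x\phi)$, and the rule from $C([\mathsf B]\phi\to\phi)$ infer $C([\mathsf B]\phi[y/x]\to[\mathsf K_{wh}]^x\phi)$. - $[\mathsf{K}^{MS}]$: the axiom $[\mathsf K]\phi[y/x]\to[\mathsf K_{wh}]^x\phi$, and the rule from $C(\neg[\mathsf K]\phi)$ infer $C(\neg[\mathsf K_{wh}]^x\phi)$. - $[\mathsf{K}^{MS}_{FS}]$: the axioms $[\mathsf K_{wh}]^x\phi\to([\mathsf B]\phi\to\phi)[y/x]$ and $[\mathsf B]\phi[y/x]\to[\mathsf B][\mathsf K_{wh}]^x\phi$, the rule from $C(\neg[\mathsf K]\phi)$ infer $C(\neg[\mathsf K_{wh}]^x\phi)$, and the rule from $C([\mathsf B]\phi\to\phi)$ infer $C([\mathsf K]\phi[y/x]\to[\mathsf K_{wh}]^x\phi)$. Then, for each of the four operators, the set $\mathbf{S4.2}^{[\mathsf K_{wh}]}_{\mathsf B}=\{\phi\mid[\mathsf B]\phi\in\mathbf{S4.2}^{[\mathsf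 K_{wh}]}\}$ is exactly the set of theorems of the system consisting of $\mathbf{S5}$ for $[\mathsf K]$ (all propositional tautologies, modus ponens, necessitation, the axioms $[\mathsf K](\phi\to\psi)\to([\mathsf K]\phi\to[\mathsf K]\psi)$, $[\mathsf K]\phi\to\phi$, $[\mathsf K]\phi\to[\mathsf K][\mathsf K]\phi$, $\neg[\mathsf K]\phi\to[\mathsf K]\neg[\mathsf K]\phi$), the axiom $[\mathsf K]\phi[y/x]\to[\mathsf K_{wh}]^x\phi$, and the rule: from $\vdash[\mathsf K]\phi\to\psi$ infer $\vdash[\mathsf K_{wh}]^x\phi\to\psi$, where $x$ is not free in $\psi$. Hence, written with the common symbol $[\mathsf K_{wh}]$, it is the same set for all four operators; and it is the $\mathbf{S5}$ logic of mention-some knowledge, i.e. the set of formulas true at every world under every assignment in all first-order Kripke models with constant non-empty domain whose accessibility relation is an equivalence relation, when $[\mathsf K_{wh}]^x\phi$ is read as $\exists x[\mathsf K]\phi$. -/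

import Mathlib

universe u

namespace KnowWh

/-- Formulas of the language with propositional knowledge `[K]` and one bundled operator
`[K_wh]^x`. The four languages of the four accounts differ only in how the symbol `[K_wh]` is read
(see `WhOp`), so they share this syntax. `ar p` is the arity of the predicate `p`. -/
inductive Form (Var Pred : Type u) (ar : Pred → ℕ) : Type u
  | atom (p : Pred) (ys : Fin (ar p) → Var) : Form Var Pred ar
  | neg (φ : Form Var Pred ar) : Form Var Pred ar
  | and (φ ψ : Form Var Pred ar) : Form Var Pred ar
  | K (φ : Form Var Pred ar) : Form Var Pred ar
  | wh (x : Var) (φ : Form Var Pred ar) : Form Var Pred ar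

/-- The four accounts of knowledge-wh:
mention-some true belief, the same with false-belief sensitivity,
mention-some knowledge, the same with false-belief sensitivity. -/
inductive WhOp
  | tBMS
  | tBMSFS
  | KMS
  | KMSFS

namespace Form

variable {Var Pred : Type u} {ar : Pred → ℕ}

/-- Material implication `φ → ψ`. -/
def imp (φ ψ : Form Var Pred ar) : Form Var Pred ar := neg (and φ (neg ψ))

/-- `⟨K⟩ φ`. -/
def dia (φ : Form Var Pred ar) : Form Var Pred ar := neg (K (neg φ))

/-- Belief: `[B] φ` abbreviates `⟨K⟩ [K] φ`. -/
def B (φ : Form Var Pred ar) : Form Var Pred ar := dia (K φ)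

/-- Free variables; `[K_wh]^x` binds `x`. -/
def fv : Form Var Pred ar → Set Var
  | atom _ ys => Set.range ys
  | neg φ => fv φ
  | and φ ψ => fv φ ∪ fv ψ
  | K φ => fv φ
  | wh x φ => fv φ \ {x}

/-- `subst x y φ` is `φ[y/x]`: every free occurrence of `x` is replaced by `y`. -/
def subst [DecidableEq Var] (x y : Var) : Form Var Pred ar → Form Var Pred ar
  | atom p ys => atom p (fun i => if ys i = x then y else ys i)
  | neg φ => neg (subst x y φ)
  | and φ ψ => and (subst x y φ) (subst x y ψ)
  | K φ => K (subst x y φ)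
  | wh z φ => if z = x then wh z φ else wh z (subst x y φ)

/-- `y` is admissible for `x` in `φ`: no free occurrence of `x` in `φ` lies in the scope of an
operator `[K_wh]^y`. -/
def Admissible (x y : Var) : Form Var Pred ar → Prop
  | atom _ _ => True
  | neg φ => Admissible x y φ
  | and φ ψ => Admissible x y φ ∧ Admissible x y ψ
  | K φ => Admissible x y φ
  | wh z φ => x ∉ fv (wh z φ) ∨ (z ≠ y ∧ Admissible x y φ)

/-- Evaluation under a valuation `v` of the propositionally atomic formulas
(atoms, `[K] φ` and `[K_wh]^x φ`). -/
def peval (v : Form Var Pred ar → Prop) : Form Var Pred ar → Prop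
  | neg φ => ¬ peval v φ
  | and φ ψ => peval v φ ∧ peval v ψ
  | atom p ys => v (atom p ys)
  | K φ => v (K φ)
  | wh x φ => v (wh x φ)

/-- Instances of propositional tautologies. -/
def IsTaut (φ : Form Var Pred ar) : Prop := ∀ v : Form Var Pred ar → Prop, peval v φ

/-- `chain ψ₀ [ψ₁, …, ψₙ] χ` is `ψ₀ → [K](ψ₁ → ⋯ [K](ψₙ → χ) ⋯)`. -/
def chain : Form Var Pred ar → List (Form Var Pred ar) → Form Var Pred ar → Form Var Pred ar
  | ψ, [], χ => imp ψ χ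
  | ψ, ψ' :: l, χ => imp ψ (K (chain ψ' l χ))

end Form

section Systems

open Form

variable {Var Pred : Type u} {ar : Pred → ℕ}

/-- Theorems of the Hilbert system with all propositional tautologies, modus ponens, necessitation
for `[K]`, the further axioms `Ax`, and the further one-premise rules `Ru`
(`Ru premise conclusion`). -/
inductive Derivable (Ax : Set (Form Var Pred ar))
    (Ru : Form Var Pred ar → Form Var Pred ar → Prop) : Form Var Pred ar → Prop
  | taut {φ : Form Var Pred ar} : IsTaut φ → Derivable Ax Ru φ
  | ax {φ : Form Var Pred ar} : φ ∈ Ax → Derivable Ax Ru φ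
  | mp {φ ψ : Form Var Pred ar} : Derivable Ax Ru (imp φ ψ) → Derivable Ax Ru φ → Derivable Ax Ru ψ
  | nec {φ : Form Var Pred ar} : Derivable Ax Ru φ → Derivable Ax Ru (K φ)
  | rule {φ ψ : Form Var Pred ar} : Ru φ ψ → Derivable Ax Ru φ → Derivable Ax Ru ψ

/-- `[K](φ → ψ) → ([K]φ → [K]ψ)`. -/
def axDist : Set (Form Var Pred ar) := {χ | ∃ φ ψ, χ = imp (K (imp φ ψ)) (imp (K φ) (K ψ))}

/-- `[K]φ → φ`. -/
def axT : Set (Form Var Pred ar) := {χ | ∃ φ, χ = imp (K φ) φ}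

/-- `[K]φ → [K][K]φ`. -/
def axFour : Set (Form Var Pred ar) := {χ | ∃ φ, χ = imp (K φ) (K (K φ))}

/-- `⟨K⟩[K]φ → [K]⟨K⟩φ`. -/
def axDotTwo : Set (Form Var Pred ar) := {χ | ∃ φ, χ = imp (dia (K φ)) (K (dia φ))}

/-- `¬[K]φ → [K]¬[K]φ`. -/
def axFive : Set (Form Var Pred ar) := {χ | ∃ φ, χ = imp (neg (K φ)) (K (neg (K φ)))}

/-- Axioms of **S4.2** for `[K]`. -/
def axS42 : Set (Form Var Pred ar) := axDist ∪ axT ∪ axFour ∪ axDotTwo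

/-- Axioms of **S5** for `[K]`. -/
def axS5 : Set (Form Var Pred ar) := axDist ∪ axT ∪ axFour ∪ axFive

/-- `([B]φ ∧ φ)[y/x] → [K_wh]^x φ`. -/
def TBtoKwh [DecidableEq Var] : Set (Form Var Pred ar) :=
  {χ | ∃ x y φ, Admissible x y φ ∧ χ = imp (subst x y (and (B φ) φ)) (wh x φ)}

/-- `[K]φ[y/x] → [K_wh]^x φ`. -/
def KtoKwh [DecidableEq Var] : Set (Form Var Pred ar) :=
  {χ | ∃ x y φ, Admissible x y φ ∧ χ = imp (K (subst x y φ)) (wh x φ)}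

/-- `[K_wh]^x φ → ([B]φ → φ)[y/x]`. -/
def KwhtoFS [DecidableEq Var] : Set (Form Var Pred ar) :=
  {χ | ∃ x y φ, Admissible x y φ ∧ χ = imp (wh x φ) (subst x y (imp (B φ) φ))}

/-- `[B]φ[y/x] → [B][K_wh]^x φ`. -/
def BtoBKwh [DecidableEq Var] : Set (Form Var Pred ar) :=
  {χ | ∃ x y φ, Admissible x y φ ∧ χ = imp (B (subst x y φ)) (B (wh x φ))}

/-- From `ψ₀ → [K](ψ₁ → ⋯ [K](ψₙ → ¬([B]φ ∧ φ)) ⋯)`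
infer `ψ₀ → [K](ψ₁ → ⋯ [K](ψₙ → ¬[K_wh]^x φ) ⋯)`, for `x` not free in any `ψᵢ`. -/
def KwhtoTB (prem concl : Form Var Pred ar) : Prop :=
  ∃ (ψ : Form Var Pred ar) (l : List (Form Var Pred ar)) (x : Var) (φ : Form Var Pred ar),
    (∀ θ ∈ ψ :: l, x ∉ fv θ) ∧
    prem = chain ψ l (neg (and (B φ) φ)) ∧ concl = chain ψ l (neg (wh x φ))

/-- From `ψ₀ → [K](ψ₁ → ⋯ [K](ψₙ → ¬[K]φ) ⋯)`
infer `ψ₀ → [K](ψ₁ → ⋯ [K](ψₙ → ¬[K_wh]^x φ) ⋯)`, for `x` not free in any `ψᵢ`. -/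
def KwhtoK (prem concl : Form Var Pred ar) : Prop :=
  ∃ (ψ : Form Var Pred ar) (l : List (Form Var Pred ar)) (x : Var) (φ : Form Var Pred ar),
    (∀ θ ∈ ψ :: l, x ∉ fv θ) ∧
    prem = chain ψ l (neg (K φ)) ∧ concl = chain ψ l (neg (wh x φ))

/-- From `ψ₀ → [K](ψ₁ → ⋯ [K](ψₙ → ([B]φ → φ)) ⋯)`
infer `ψ₀ → [K](ψ₁ → ⋯ [K](ψₙ → ([B]φ[y/x] → [K_wh]^x φ)) ⋯)`, for `x` not free in any `ψᵢ`. -/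
def FSBtoKwh [DecidableEq Var] (prem concl : Form Var Pred ar) : Prop :=
  ∃ (ψ : Form Var Pred ar) (l : List (Form Var Pred ar)) (x y : Var) (φ : Form Var Pred ar),
    (∀ θ ∈ ψ :: l, x ∉ fv θ) ∧ Admissible x y φ ∧
    prem = chain ψ l (imp (B φ) φ) ∧ concl = chain ψ l (imp (B (subst x y φ)) (wh x φ))

/-- From `ψ₀ → [K](ψ₁ → ⋯ [K](ψₙ → ([B]φ → φ)) ⋯)`
infer `ψ₀ → [K](ψ₁ → ⋯ [K](ψₙ → ([K]φ[y/x] → [K_wh]^x φ)) ⋯)`, for `x` not free in any `ψᵢ`. -/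
def FSKtoKwh [DecidableEq Var] (prem concl : Form Var Pred ar) : Prop :=
  ∃ (ψ : Form Var Pred ar) (l : List (Form Var Pred ar)) (x y : Var) (φ : Form Var Pred ar),
    (∀ θ ∈ ψ :: l, x ∉ fv θ) ∧ Admissible x y φ ∧
    prem = chain ψ l (imp (B φ) φ) ∧ concl = chain ψ l (imp (K (subst x y φ)) (wh x φ))

/-- From `[K]φ → ψ` infer `[K_wh]^x φ → ψ`, for `x` not free in `ψ`. -/
def KwhtoKZero (prem concl : Form Var Pred ar) : Prop :=
  ∃ (x : Var) (φ ψ : Form Var Pred ar),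
    x ∉ fv ψ ∧ prem = imp (K φ) ψ ∧ concl = imp (wh x φ) ψ

/-- The axioms for `[K_wh]` in each of the four logics. -/
def whAxioms [DecidableEq Var] : WhOp → Set (Form Var Pred ar)
  | .tBMS => TBtoKwh
  | .tBMSFS => KwhtoFS ∪ BtoBKwh
  | .KMS => KtoKwh
  | .KMSFS => KwhtoFS ∪ BtoBKwh

/-- The rules for `[K_wh]` in each of the four logics. -/
def whRules [DecidableEq Var] : WhOp → Form Var Pred ar → Form Var Pred ar → Prop
  | .tBMS => KwhtoTB
  | .tBMSFS => fun α β => KwhtoTB α β ∨ FSBtoKwh α β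
  | .KMS => KwhtoK
  | .KMSFS => fun α β => KwhtoK α β ∨ FSKtoKwh α β

end Systems

/-- The logic **S4.2**`^[K_wh]`, as its set of theorems. -/
def S42Wh (Var Pred : Type u) (ar : Pred → ℕ) [DecidableEq Var] (o : WhOp) :
    Set (Form Var Pred ar) :=
  {φ | Derivable (axS42 ∪ whAxioms o) (whRules o) φ}

/-- The set of theorems of **S5** for `[K]` plus `[K]φ[y/x] → [K_wh]^x φ` plus the rule
`KwhtoKZero`. -/
def S5Wh (Var Pred : Type u) (ar : Pred → ℕ) [DecidableEq Var] : Set (Form Var Pred ar) :=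
  {φ | Derivable (axS5 ∪ KtoKwh) KwhtoKZero φ}

/-- `L_B = {φ | [B]φ ∈ L}`. -/
def believed {Var Pred : Type u} {ar : Pred → ℕ} (L : Set (Form Var Pred ar)) :
    Set (Form Var Pred ar) :=
  {φ | Form.B φ ∈ L}

section Semantics

/-- First-order Kripke models with a constant domain. -/
structure Model (Pred : Type u) (ar : Pred → ℕ) where
  W : Type u
  D : Type u
  nonempty_W : Nonempty W
  nonempty_D : Nonempty D
  R : W → W → Prop
  ρ : (p : Pred) → W → Set (Fin (ar p) → D)

/-- Truth of `[K]` at `w` for the condition `S`. -/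
def KHolds {W : Type u} (R : W → W → Prop) (w : W) (S : W → Prop) : Prop := ∀ v, R w v → S v

/-- Truth of `[B] = ⟨K⟩[K]` at `w` for the condition `S`. -/
def BHolds {W : Type u} (R : W → W → Prop) (w : W) (S : W → Prop) : Prop :=
  ∃ v, R w v ∧ KHolds R v S

/-- Truth of `[K_wh]^x φ` at `w` under each of the four readings, where `S a v` says that `φ` is
true at `v` when `x` denotes `a`. -/
def WhOp.Holds {W D : Type u} (R : W → W → Prop) (w : W) (S : D → W → Prop) : WhOp → Prop
  | .tBMS => ∃ a, BHolds R w (S a) ∧ S a w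
  | .tBMSFS => (∃ a, BHolds R w (S a) ∧ S a w) ∧ ∀ b, BHolds R w (S b) → S b w
  | .KMS => ∃ a, KHolds R w (S a)
  | .KMSFS => (∃ a, KHolds R w (S a)) ∧ ∀ b, BHolds R w (S b) → S b w

variable {Var Pred : Type u} {ar : Pred → ℕ}

/-- Truth of a formula at a world under an assignment, with `[K_wh]` read as `o`. -/
def Model.Sat [DecidableEq Var] (M : Model Pred ar) (o : WhOp) :
    Form Var Pred ar → M.W → (Var → M.D) → Prop
  | .atom p ys, w, σ => (fun i => σ (ys i)) ∈ M.ρ p w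
  | .neg φ, w, σ => ¬ M.Sat o φ w σ
  | .and φ ψ, w, σ => M.Sat o φ w σ ∧ M.Sat o ψ w σ
  | .K φ, w, σ => KHolds M.R w (fun v => M.Sat o φ v σ)
  | .wh x φ, w, σ => o.Holds M.R w (fun a v => M.Sat o φ v (Function.update σ x a))

/-- Validity on all models whose accessibility relation is an equivalence relation, with `[K_wh]`
read as `o`. -/
def ValidS5 [DecidableEq Var] (o : WhOp) (φ : Form Var Pred ar) : Prop :=
  ∀ M : Model.{u} Pred ar, Equivalence M.R →
    ∀ (w : M.W) (σ : Var → M.D), M.Sat o φ w σ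

end Semantics

end KnowWh

/-!
Over **S4.2** the belief operator `[B] = ⟨K⟩[K]` is a normal modality, and negative introspection of
`[K]`, although not a theorem, is believed. Prefixing `[B]` to every line of an **S5** derivation
therefore gives an **S4.2** derivation; the rule for `[K_wh]` passes through the chained rule with
prefix `¬[B]ψ → [K](⊤ → ·)`, which is available because disbelief is known.

Conversely, `[B]` and `[K]` coincide on equivalence relations, so each of the four logics is sound
there for the mention-some reading of `[K_wh]`, and what it believes is valid.

A Henkin construction closes the circle. Universal quantification of `[K]φ` is expressible as
`¬[K_wh]^x ¬[K]φ`, so it is enough to treat closed formulas, and infinitely many variables not bound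
in such a formula can serve as individuals. With countably many individuals only countably many
`[K_wh]`-formulas need witnesses, so the Rasiowa–Sikorski lemma applies even to uncountable
languages.
-/

namespace KnowWh

open Form

section Theories

variable {Var Pred : Type u} {ar : Pred → ℕ}

section Peval

variable (v : Form Var Pred ar → Prop) (φ ψ : Form Var Pred ar)

theorem peval_neg : peval v (neg φ) ↔ ¬ peval v φ := Iff.rfl

theorem peval_and : peval v (and φ ψ) ↔ peval v φ ∧ peval v ψ := Iff.rfl

theorem peval_imp : peval v (imp φ ψ) ↔ (peval v φ → peval v ψ) := by
  simp only [imp, peval_neg, peval_and, not_and, not_not]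

theorem peval_dia : peval v (dia φ) ↔ ¬ peval v (K (neg φ)) := Iff.rfl

theorem peval_B : peval v (B φ) ↔ ¬ peval v (K (neg (K φ))) := Iff.rfl

end Peval

/-- Sets of formulas closed under propositional consequence. -/
structure IsTheory (T : Set (Form Var Pred ar)) : Prop where
  taut_mem : ∀ {φ}, IsTaut φ → φ ∈ T
  mp_mem : ∀ {φ ψ}, imp φ ψ ∈ T → φ ∈ T → ψ ∈ T

/-- Maximal consistent sets of formulas, with consistency and maximality expressed together as
“exactly one of `φ` and `¬φ` is a member”. -/
structure IsMaxCons (Γ : Set (Form Var Pred ar)) : Prop extends IsTheory Γ where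
  neg_mem_iff : ∀ {φ}, neg φ ∈ Γ ↔ φ ∉ Γ

variable {T Γ : Set (Form Var Pred ar)} {α β φ ψ : Form Var Pred ar}

theorem IsTheory.conseq (hT : IsTheory T) (hα : α ∈ T) (t : IsTaut (imp α φ)) : φ ∈ T :=
  hT.mp_mem (hT.taut_mem t) hα

theorem IsTheory.conseq₂ (hT : IsTheory T) (hα : α ∈ T) (hβ : β ∈ T)
    (t : IsTaut (imp α (imp β φ))) : φ ∈ T :=
  hT.mp_mem (hT.conseq hα t) hβ

theorem IsTheory.setOf_imp_mem (hT : IsTheory T) (α : Form Var Pred ar) :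
    IsTheory {φ | imp α φ ∈ T} where
  taut_mem h := hT.taut_mem fun v => by grind [peval_imp, h v]
  mp_mem h₁ h₂ := hT.conseq₂ h₁ h₂ fun v => by grind [peval_imp]

theorem IsTheory.sUnion {c : Set (Set (Form Var Pred ar))} (hc : IsChain (· ⊆ ·) c)
    (hne : c.Nonempty) (h : ∀ S ∈ c, IsTheory S) : IsTheory (⋃₀ c) where
  taut_mem t := hne.elim fun S hS => ⟨S, hS, (h S hS).taut_mem t⟩
  mp_mem := by
    rintro φ ψ ⟨S, hS, hφψ⟩ ⟨S', hS', hφ⟩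
    rcases hc.total hS hS' with hle | hle
    · exact ⟨S', hS', (h S' hS').mp_mem (hle hφψ) hφ⟩
    · exact ⟨S, hS, (h S hS).mp_mem hφψ (hle hφ)⟩

theorem IsTheory.isMaxCons_of_maximal (h : Maximal (fun S => IsTheory S ∧ ψ ∉ S) Γ) :
    IsMaxCons Γ := by
  obtain ⟨hΓ, hψ⟩ := h.prop
  have imp_mem : ∀ α, α ∉ Γ → imp α ψ ∈ Γ := by
    intro α hα
    by_contra hαψ
    have hle : Γ ⊆ {φ | imp α φ ∈ Γ} := fun φ hφ => hΓ.conseq hφ fun v => by grind [peval_imp]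
    exact hα (h.le_of_ge ⟨hΓ.setOf_imp_mem α, hαψ⟩ hle (hΓ.taut_mem fun v => by grind [peval_imp]))
  refine ⟨hΓ, fun {φ} => ⟨fun hn hφ => hψ ?_, fun hφ => ?_⟩⟩
  · exact hΓ.conseq₂ hn hφ fun v => by grind [peval_imp, peval_neg]
  · by_contra hn
    exact hψ (hΓ.conseq₂ (imp_mem _ hφ) (imp_mem _ hn) fun v => by grind [peval_imp, peval_neg])

theorem IsTheory.exists_isMaxCons (hT : IsTheory T) (hψ : ψ ∉ T) :
    ∃ Γ, IsMaxCons Γ ∧ T ⊆ Γ ∧ ψ ∉ Γ := by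
  obtain ⟨Γ, hTΓ, hΓ⟩ := zorn_subset_nonempty {S | IsTheory S ∧ ψ ∉ S}
    (fun c hc hchain hne => ⟨⋃₀ c,
      ⟨.sUnion hchain hne fun S hS => (hc hS).1, fun ⟨_, hS, h⟩ => (hc hS).2 h⟩,
      fun _ => Set.subset_sUnion_of_mem⟩) T ⟨hT, hψ⟩
  exact ⟨Γ, isMaxCons_of_maximal hΓ, hTΓ, hΓ.prop.2⟩

theorem IsMaxCons.and_mem_iff (hΓ : IsMaxCons Γ) : and φ ψ ∈ Γ ↔ φ ∈ Γ ∧ ψ ∈ Γ :=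
  ⟨fun h => ⟨hΓ.conseq h fun v => by grind [peval_imp, peval_and],
      hΓ.conseq h fun v => by grind [peval_imp, peval_and]⟩,
    fun h => hΓ.conseq₂ h.1 h.2 fun v => by grind [peval_imp, peval_and]⟩

end Theories

section ModalCalculus

variable {Var Pred : Type u} {ar : Pred → ℕ} {Ax : Set (Form Var Pred ar)}
  {Ru : Form Var Pred ar → Form Var Pred ar → Prop} {α β γ φ ψ χ : Form Var Pred ar}

namespace Derivable

theorem conseq (hα : Derivable Ax Ru α) (t : IsTaut (imp α φ)) : Derivable Ax Ru φ :=
  mp (taut t) hα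

theorem conseq₂ (hα : Derivable Ax Ru α) (hβ : Derivable Ax Ru β)
    (t : IsTaut (imp α (imp β φ))) : Derivable Ax Ru φ :=
  mp (conseq hα t) hβ

theorem conseq₃ (hα : Derivable Ax Ru α) (hβ : Derivable Ax Ru β) (hγ : Derivable Ax Ru γ)
    (t : IsTaut (imp α (imp β (imp γ φ)))) : Derivable Ax Ru φ :=
  mp (conseq₂ hα hβ t) hγ

theorem trans (h₁ : Derivable Ax Ru (imp α β)) (h₂ : Derivable Ax Ru (imp β γ)) :
    Derivable Ax Ru (imp α γ) :=
  conseq₂ h₁ h₂ fun v => by grind [peval_imp]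

theorem dist (hK : axDist ⊆ Ax) (φ ψ : Form Var Pred ar) :
    Derivable Ax Ru (imp (K (imp φ ψ)) (imp (K φ) (K ψ))) :=
  ax (hK ⟨φ, ψ, rfl⟩)

theorem K_imp_self (hT : axT ⊆ Ax) (φ : Form Var Pred ar) : Derivable Ax Ru (imp (K φ) φ) :=
  ax (hT ⟨φ, rfl⟩)

theorem K_imp_KK (h4 : axFour ⊆ Ax) (φ : Form Var Pred ar) :
    Derivable Ax Ru (imp (K φ) (K (K φ))) :=
  ax (h4 ⟨φ, rfl⟩)

theorem K_mono (hK : axDist ⊆ Ax) (h : Derivable Ax Ru (imp φ ψ)) :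
    Derivable Ax Ru (imp (K φ) (K ψ)) :=
  mp (dist hK φ ψ) (nec h)

theorem dia_mono (hK : axDist ⊆ Ax) (h : Derivable Ax Ru (imp φ ψ)) :
    Derivable Ax Ru (imp (dia φ) (dia ψ)) := by
  have hneg : Derivable Ax Ru (imp (K (neg ψ)) (K (neg φ))) :=
    K_mono hK (h.conseq fun v => by grind [peval_imp, peval_neg])
  exact hneg.conseq fun v => by grind [peval_imp, peval_dia]

theorem B_mono (hK : axDist ⊆ Ax) (h : Derivable Ax Ru (imp φ ψ)) :
    Derivable Ax Ru (imp (B φ) (B ψ)) :=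
  dia_mono hK (K_mono hK h)

theorem K_imp_dia_imp_dia (hK : axDist ⊆ Ax) (φ ψ : Form Var Pred ar) :
    Derivable Ax Ru (imp (K (imp φ ψ)) (imp (dia φ) (dia ψ))) := by
  have hneg : Derivable Ax Ru (imp (K (imp φ ψ)) (K (imp (neg ψ) (neg φ)))) :=
    K_mono hK (taut fun v => by grind [peval_imp, peval_neg])
  exact (hneg.trans (dist hK _ _)).conseq fun v => by grind [peval_imp, peval_dia]

theorem dia_imp_K_imp_dia (hK : axDist ⊆ Ax) (φ ψ : Form Var Pred ar) :
    Derivable Ax Ru (imp (dia (imp φ ψ)) (imp (K φ) (dia ψ))) := by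
  have hneg : Derivable Ax Ru (imp (K φ) (K (imp (neg ψ) (neg (imp φ ψ))))) :=
    K_mono hK (taut fun v => by grind [peval_imp, peval_neg])
  exact (hneg.trans (dist hK _ _)).conseq fun v => by grind [peval_imp, peval_dia]

theorem dia_dia_imp_dia (hK : axDist ⊆ Ax) (h4 : axFour ⊆ Ax) (φ : Form Var Pred ar) :
    Derivable Ax Ru (imp (dia (dia φ)) (dia φ)) := by
  have hneg : Derivable Ax Ru (imp (K (K (neg φ))) (K (neg (dia φ)))) :=
    K_mono hK (taut fun v => by grind [peval_imp, peval_neg, peval_dia])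
  exact ((K_imp_KK h4 (neg φ)).trans hneg).conseq fun v => by grind [peval_imp, peval_dia]

theorem K_imp_B (hT : axT ⊆ Ax) (φ : Form Var Pred ar) : Derivable Ax Ru (imp (K φ) (B φ)) :=
  (K_imp_self hT (neg (K φ))).conseq fun v => by grind [peval_imp, peval_neg, peval_B]

theorem believe (hT : axT ⊆ Ax) (h : Derivable Ax Ru φ) : Derivable Ax Ru (B φ) :=
  mp (K_imp_B hT φ) (nec h)

theorem neg_B_imp_K_neg_B (hK : axDist ⊆ Ax) (h4 : axFour ⊆ Ax) (φ : Form Var Pred ar) :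
    Derivable Ax Ru (imp (neg (B φ)) (K (neg (B φ)))) := by
  have h : Derivable Ax Ru (imp (K (K (neg (K φ)))) (K (neg (B φ)))) :=
    K_mono hK (taut fun v => by grind [peval_imp, peval_neg, peval_B])
  exact ((K_imp_KK h4 (neg (K φ))).trans h).conseq fun v => by grind [peval_imp, peval_neg, peval_B]

theorem B_imp_BK (hK : axDist ⊆ Ax) (h4 : axFour ⊆ Ax) (φ : Form Var Pred ar) :
    Derivable Ax Ru (imp (B φ) (B (K φ))) :=
  dia_mono hK (K_imp_KK h4 φ)

theorem B_imp_KB (hK : axDist ⊆ Ax) (h4 : axFour ⊆ Ax) (h2 : axDotTwo ⊆ Ax)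
    (φ : Form Var Pred ar) : Derivable Ax Ru (imp (B φ) (K (B φ))) :=
  (B_imp_BK hK h4 φ).trans (ax (h2 ⟨K φ, rfl⟩))

theorem B_dist (hK : axDist ⊆ Ax) (h4 : axFour ⊆ Ax) (h2 : axDotTwo ⊆ Ax)
    (φ ψ : Form Var Pred ar) : Derivable Ax Ru (imp (B (imp φ ψ)) (imp (B φ) (B ψ))) := by
  have K_imp_B_imp_B : Derivable Ax Ru (imp (K (imp φ ψ)) (imp (B φ) (B ψ))) :=
    (K_imp_KK h4 _).trans ((K_mono hK (dist hK φ ψ)).trans (K_imp_dia_imp_dia hK _ _))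
  have B_imp_KB_imp_dia : Derivable Ax Ru (imp (B (imp φ ψ)) (imp (K (B φ)) (dia (B ψ)))) :=
    (dia_mono hK K_imp_B_imp_B).trans (dia_imp_K_imp_dia hK _ _)
  have dia_B_imp_B : Derivable Ax Ru (imp (dia (B ψ)) (B ψ)) := dia_dia_imp_dia hK h4 (K ψ)
  exact conseq₃ B_imp_KB_imp_dia (B_imp_KB hK h4 h2 φ) dia_B_imp_B fun v => by grind [peval_imp]

/-- Negative introspection need not hold, but it is believed: `[B]φ` gives `[B][K]φ`, and the
alternative `[K]¬[K]φ` is itself known. -/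
theorem B_five (hK : axDist ⊆ Ax) (hT : axT ⊆ Ax) (h4 : axFour ⊆ Ax) (φ : Form Var Pred ar) :
    Derivable Ax Ru (B (imp (neg (K φ)) (K (neg (K φ))))) := by
  have of_B : Derivable Ax Ru (imp (B φ) (B (imp (neg (K φ)) (K (neg (K φ)))))) :=
    (B_imp_BK hK h4 φ).trans (B_mono hK (taut fun v => by grind [peval_imp, peval_neg]))
  have of_K : Derivable Ax Ru (imp (K (neg (K φ))) (B (imp (neg (K φ)) (K (neg (K φ)))))) :=
    (K_imp_KK h4 _).trans ((K_imp_B hT _).trans (B_mono hK (taut fun v => by grind [peval_imp])))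
  exact conseq₂ of_B of_K fun v => by grind [peval_imp, peval_B]

theorem B_K_imp (hK : axDist ⊆ Ax) (hT : axT ⊆ Ax) (h : Derivable Ax Ru (imp (B φ) (B χ))) :
    Derivable Ax Ru (B (imp (K φ) χ)) := by
  have of_B : Derivable Ax Ru (imp (B φ) (B (imp (K φ) χ))) :=
    h.trans (B_mono hK (taut fun v => by grind [peval_imp]))
  have of_K : Derivable Ax Ru (imp (K (neg (K φ))) (B (imp (K φ) χ))) :=
    (K_imp_B hT _).trans (B_mono hK (taut fun v => by grind [peval_imp, peval_neg]))
  exact conseq₂ of_B of_K fun v => by grind [peval_imp, peval_B]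

/-- This is the premise of the chained rules with `ψ₀ = ¬[B]ψ`: disbelief is known, so it can be
carried inside `[K]`. The trivial `ψ₁ = ψ → ψ` only serves to provide that `[K]`. -/
theorem chain_neg_B (hK : axDist ⊆ Ax) (h4 : axFour ⊆ Ax) (h2 : axDotTwo ⊆ Ax)
    (h : Derivable Ax Ru (B (imp (K φ) ψ))) (hχ : Derivable Ax Ru (imp χ (B φ))) :
    Derivable Ax Ru (chain (neg (B ψ)) [imp ψ ψ] (neg χ)) := by
  have hB : Derivable Ax Ru (imp (B φ) (B ψ)) :=
    (B_imp_BK hK h4 φ).trans (mp (B_dist hK h4 h2 _ _) h)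
  have hneg : Derivable Ax Ru (imp (neg (B ψ)) (imp (imp ψ ψ) (neg χ))) :=
    conseq₂ hB hχ fun v => by grind [peval_imp, peval_neg]
  exact (neg_B_imp_K_neg_B hK h4 ψ).trans (K_mono hK hneg)

theorem B_imp_of_chain (hK : axDist ⊆ Ax) (hT : axT ⊆ Ax)
    (h : Derivable Ax Ru (chain (neg (B ψ)) [imp ψ ψ] (neg χ))) :
    Derivable Ax Ru (B (imp χ ψ)) := by
  have of_neg_B : Derivable Ax Ru (imp (neg (B ψ)) (B (imp χ ψ))) :=
    trans h ((K_imp_B hT _).trans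
      (B_mono hK (taut fun v => by grind [peval_imp, peval_neg, chain])))
  have of_B : Derivable Ax Ru (imp (B ψ) (B (imp χ ψ))) :=
    B_mono hK (taut fun v => by grind [peval_imp])
  exact conseq₂ of_neg_B of_B fun v => by grind [peval_imp, peval_neg]

end Derivable

end ModalCalculus

section BelievedS5

open Derivable

variable {Var Pred : Type u} {ar : Pred → ℕ} {X : Set (Form Var Pred ar)}

theorem axDist_subset_axS42_union : axDist ⊆ axS42 ∪ X := fun _ h => .inl (.inl (.inl (.inl h)))

theorem axT_subset_axS42_union : axT ⊆ axS42 ∪ X := fun _ h => .inl (.inl (.inl (.inr h)))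

theorem axFour_subset_axS42_union : axFour ⊆ axS42 ∪ X := fun _ h => .inl (.inl (.inr h))

theorem axDotTwo_subset_axS42_union : axDotTwo ⊆ axS42 ∪ X := fun _ h => .inl (.inr h)

variable [DecidableEq Var] (o : WhOp)

/-- Theoremhood in `S42Wh`. -/
abbrev S42Thm (φ : Form Var Pred ar) : Prop := Derivable (axS42 ∪ whAxioms o) (whRules o) φ

theorem S42Thm.B_KtoKwh {x y : Var} {φ : Form Var Pred ar} (hxy : Admissible x y φ) :
    S42Thm o (B (imp (K (subst x y φ)) (wh x φ))) := by
  cases o with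
  | tBMS =>
    have h : S42Thm .tBMS (imp (and (B (subst x y φ)) (subst x y φ)) (wh x φ)) :=
      ax (.inr ⟨x, y, φ, hxy, rfl⟩)
    exact believe axT_subset_axS42_union (conseq₃ h
      (K_imp_self axT_subset_axS42_union (subst x y φ))
      (K_imp_B axT_subset_axS42_union (subst x y φ)) fun v => by grind [peval_imp, peval_and])
  | KMS => exact believe axT_subset_axS42_union (ax (.inr ⟨x, y, φ, hxy, rfl⟩))
  | tBMSFS | KMSFS =>
    exact B_K_imp axDist_subset_axS42_union axT_subset_axS42_union
      (ax (.inr (.inr ⟨x, y, φ, hxy, rfl⟩)))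

theorem S42Thm.B_KwhtoKZero {x : Var} {φ ψ : Form Var Pred ar} (hx : x ∉ fv ψ)
    (h : S42Thm o (B (imp (K φ) ψ))) : S42Thm o (B (imp (wh x φ) ψ)) := by
  have hfv : ∀ θ ∈ [neg (B ψ), imp ψ ψ], x ∉ fv θ := by simp [B, dia, imp, fv, hx]
  have chain_of_imp_B {χ : Form Var Pred ar} (hχ : S42Thm o (imp χ (B φ))) :
      S42Thm o (chain (neg (B ψ)) [imp ψ ψ] (neg χ)) :=
    chain_neg_B axDist_subset_axS42_union axFour_subset_axS42_union axDotTwo_subset_axS42_union h hχ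
  have hK : S42Thm o (chain (neg (B ψ)) [imp ψ ψ] (neg (K φ))) :=
    chain_of_imp_B (K_imp_B axT_subset_axS42_union φ)
  have hB : S42Thm o (chain (neg (B ψ)) [imp ψ ψ] (neg (and (B φ) φ))) :=
    chain_of_imp_B (taut fun v => by grind [peval_imp, peval_and])
  refine B_imp_of_chain axDist_subset_axS42_union axT_subset_axS42_union ?_
  cases o with
  | tBMS => exact rule ⟨_, _, x, φ, hfv, rfl, rfl⟩ hB
  | tBMSFS => exact rule (.inl ⟨_, _, x, φ, hfv, rfl, rfl⟩) hB
  | KMS => exact rule ⟨_, _, x, φ, hfv, rfl, rfl⟩ hK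
  | KMSFS => exact rule (.inl ⟨_, _, x, φ, hfv, rfl, rfl⟩) hK

theorem S5Wh_subset_believed : S5Wh Var Pred ar ⊆ believed (S42Wh Var Pred ar o) := by
  intro φ h
  change S42Thm o (B φ)
  induction h with
  | taut t => exact believe axT_subset_axS42_union (taut t)
  | ax h =>
    rcases h with (((h | h) | h) | ⟨φ, rfl⟩) | ⟨x, y, φ, hxy, rfl⟩
    · exact believe axT_subset_axS42_union (ax (axDist_subset_axS42_union h))
    · exact believe axT_subset_axS42_union (ax (axT_subset_axS42_union h))
    · exact believe axT_subset_axS42_union (ax (axFour_subset_axS42_union h))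
    · exact B_five axDist_subset_axS42_union axT_subset_axS42_union axFour_subset_axS42_union φ
    · exact S42Thm.B_KtoKwh o hxy
  | mp _ _ ih₁ ih₂ =>
    exact mp (mp (B_dist axDist_subset_axS42_union axFour_subset_axS42_union
      axDotTwo_subset_axS42_union _ _) ih₁) ih₂
  | nec _ ih => exact mp (B_imp_BK axDist_subset_axS42_union axFour_subset_axS42_union _) ih
  | rule r _ ih =>
    obtain ⟨x, φ, ψ, hx, rfl, rfl⟩ := r
    exact S42Thm.B_KwhtoKZero o hx ih

end BelievedS5

section Renaming

variable {Var Pred : Type u} {ar : Pred → ℕ}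

/-- The variables that are bound somewhere in a formula. -/
def bv : Form Var Pred ar → Set Var
  | .atom _ _ => ∅
  | .neg φ => bv φ
  | .and φ ψ => bv φ ∪ bv ψ
  | .K φ => bv φ
  | .wh x φ => insert x (bv φ)

theorem finite_fv (φ : Form Var Pred ar) : (fv φ).Finite := by
  induction φ with
  | atom => exact Set.finite_range _
  | neg _ ih => exact ih
  | and _ _ ih₁ ih₂ => exact ih₁.union ih₂
  | K _ ih => exact ih
  | wh _ _ ih => exact ih.sdiff

theorem finite_bv (φ : Form Var Pred ar) : (bv φ).Finite := by
  induction φ with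
  | atom => exact Set.finite_empty
  | neg _ ih => exact ih
  | and _ _ ih₁ ih₂ => exact ih₁.union ih₂
  | K _ ih => exact ih
  | wh x _ ih => exact ih.insert x

theorem admissible_of_notMem_bv {x y : Var} {φ : Form Var Pred ar} (hy : y ∉ bv φ) :
    Admissible x y φ := by
  induction φ with
  | atom => trivial
  | neg _ ih => exact ih hy
  | and _ _ ih₁ ih₂ => exact ⟨ih₁ fun h => hy (.inl h), ih₂ fun h => hy (.inr h)⟩
  | K _ ih => exact ih hy
  | wh _ _ ih => exact .inr ⟨fun h => hy (.inl h.symm), ih fun h => hy (.inr h)⟩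

theorem admissible_self (x : Var) (φ : Form Var Pred ar) : Admissible x x φ := by
  induction φ with
  | atom => trivial
  | neg _ ih => exact ih
  | and _ _ ih₁ ih₂ => exact ⟨ih₁, ih₂⟩
  | K _ ih => exact ih
  | wh z _ ih =>
    rcases eq_or_ne z x with hz | hz
    · exact .inl fun h => h.2 hz.symm
    · exact .inr ⟨hz, ih⟩

variable [DecidableEq Var]

/-- Simultaneous replacement of every free variable `z` by `σ z`. Bound variables are left alone,
so variables may be captured, as for `Form.subst`. -/
def rename (σ : Var → Var) : Form Var Pred ar → Form Var Pred ar
  | .atom p ys => .atom p (σ ∘ ys)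
  | .neg φ => .neg (rename σ φ)
  | .and φ ψ => .and (rename σ φ) (rename σ ψ)
  | .K φ => .K (rename σ φ)
  | .wh x φ => .wh x (rename (Function.update σ x x) φ)

variable {σ τ : Var → Var} {φ : Form Var Pred ar} {x y : Var}

theorem rename_congr (h : ∀ z ∈ fv φ, σ z = τ z) : rename σ φ = rename τ φ := by
  induction φ generalizing σ τ with
  | atom =>
    simp only [rename, Form.atom.injEq, heq_eq_eq, true_and]
    exact funext fun i => h _ ⟨i, rfl⟩
  | neg _ ih => simp only [rename, ih h]
  | and _ _ ih₁ ih₂ =>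
    simp only [rename, ih₁ fun z hz => h z (.inl hz), ih₂ fun z hz => h z (.inr hz)]
  | K _ ih => simp only [rename, ih h]
  | wh x _ ih =>
    simp only [rename]
    congr 1
    refine ih fun z hz => ?_
    rcases eq_or_ne z x with rfl | hzx
    · simp
    · simpa [hzx] using h z ⟨hz, hzx⟩

theorem rename_id (φ : Form Var Pred ar) : rename id φ = φ := by
  induction φ with
  | atom => rfl
  | neg _ ih => simp only [rename, ih]
  | and _ _ ih₁ ih₂ => simp only [rename, ih₁, ih₂]
  | K _ ih => simp only [rename, ih]
  | wh x _ ih => rw [rename, show Function.update id x x = id from Function.update_eq_self x id, ih]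

theorem rename_eq_self (h : ∀ z ∈ fv φ, σ z = z) : rename σ φ = φ :=
  (rename_congr h).trans (rename_id φ)

theorem subst_eq_rename (x y : Var) (φ : Form Var Pred ar) :
    subst x y φ = rename (Function.update id x y) φ := by
  induction φ with
  | atom => simp only [subst, rename, Function.comp_def, Function.update_apply, id]
  | neg _ ih => simp only [subst, rename, ih]
  | and _ _ ih₁ ih₂ => simp only [subst, rename, ih₁, ih₂]
  | K _ ih => simp only [subst, rename, ih]
  | wh z φ ih =>
    rcases eq_or_ne z x with rfl | hz
    · rw [subst, if_pos rfl, rename, Function.update_idem,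
        show Function.update id z z = id from Function.update_eq_self z id, rename_id]
    · have hid : Function.update (Function.update id x y) z z = Function.update id x y := by
        rw [Function.update_eq_self_iff, Function.update_of_ne hz, id]
      rw [subst, if_neg hz, rename, ih, hid]

theorem subst_self (x : Var) (φ : Form Var Pred ar) : subst x x φ = φ := by
  have hid : Function.update id x x = id := Function.update_eq_self x id
  rw [subst_eq_rename, hid, rename_id]

theorem subst_of_notMem_fv (hx : x ∉ fv φ) : subst x y φ = φ := by
  rw [subst_eq_rename, rename_eq_self]
  rintro z hz
  rw [Function.update_of_ne (ne_of_mem_of_not_mem hz hx), id]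

theorem bv_rename (σ : Var → Var) (φ : Form Var Pred ar) : bv (rename σ φ) = bv φ := by
  induction φ generalizing σ with
  | atom => rfl
  | neg _ ih | K _ ih | wh _ _ ih => simp only [rename, bv, ih]
  | and _ _ ih₁ ih₂ => simp only [rename, bv, ih₁, ih₂]

theorem fv_rename_subset (σ : Var → Var) (φ : Form Var Pred ar) :
    fv (rename σ φ) ⊆ σ '' fv φ := by
  induction φ generalizing σ with
  | atom p ys => exact (Set.range_comp σ ys).subset
  | neg _ ih | K _ ih => exact ih σ
  | and _ _ ih₁ ih₂ =>
    simp only [rename, fv, Set.image_union]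
    exact Set.union_subset_union (ih₁ σ) (ih₂ σ)
  | wh x _ ih =>
    rintro _ ⟨hz, hzx⟩
    obtain ⟨t, ht, rfl⟩ := ih _ hz
    rcases eq_or_ne t x with rfl | htx
    · simp at hzx
    · exact ⟨t, ⟨ht, htx⟩, by simp [htx]⟩

/-- The hypothesis says that the inner renaming causes no capture. -/
theorem rename_rename (h : ∀ z ∈ fv φ, σ z ∈ bv φ → σ z = z) :
    rename τ (rename σ φ) = rename (τ ∘ σ) φ := by
  induction φ generalizing σ τ with
  | atom => rfl
  | neg _ ih | K _ ih => simp only [rename, ih h]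
  | and _ _ ih₁ ih₂ =>
    simp only [rename, ih₁ fun z hz hb => h z (.inl hz) (.inl hb),
      ih₂ fun z hz hb => h z (.inr hz) (.inr hb)]
  | wh x φ ih =>
    have hx : ∀ z ∈ fv φ, z ≠ x → σ z ≠ x := fun z hz hzx hσ =>
      hzx ((h z ⟨hz, hzx⟩ (.inl hσ)).symm.trans hσ)
    have hφ : ∀ z ∈ fv φ, Function.update σ x x z ∈ bv φ → Function.update σ x x z = z := by
      intro z hz hb
      rcases eq_or_ne z x with rfl | hzx
      · simp
      · rw [Function.update_of_ne hzx] at hb ⊢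
        exact h z ⟨hz, hzx⟩ (.inr hb)
    simp only [rename, ih hφ]
    congr 1
    refine rename_congr fun z hz => ?_
    rcases eq_or_ne z x with rfl | hzx
    · simp
    · simp [hzx, hx z hz hzx]

theorem subst_rename_update {a : Var} (hx : ∀ z ∈ fv φ, z ≠ x → σ z ≠ x)
    (hb : ∀ z ∈ fv φ, σ z ∉ bv φ) :
    subst x a (rename (Function.update σ x x) φ) = rename (Function.update σ x a) φ := by
  rw [subst_eq_rename, rename_rename]
  · refine rename_congr fun z hz => ?_
    rcases eq_or_ne z x with rfl | hzx
    · simp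
    · simp [hzx, hx z hz hzx]
  · intro z hz h
    rcases eq_or_ne z x with rfl | hzx
    · simp
    · exact absurd (by rwa [Function.update_of_ne hzx] at h) (hb z hz)

theorem subst_subst_cancel (hy : y ∉ fv φ) (hb : y ∉ bv φ) : subst y x (subst x y φ) = φ := by
  rw [subst_eq_rename, subst_eq_rename, rename_rename, rename_eq_self]
  · intro z hz
    rcases eq_or_ne z x with rfl | hzx
    · simp
    · simp [hzx, ne_of_mem_of_not_mem hz hy]
  · intro z _ h
    rcases eq_or_ne z x with rfl | hzx
    · simp [hb] at h
    · simp [hzx]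

theorem notMem_fv_subst (hxy : x ≠ y) (φ : Form Var Pred ar) : x ∉ fv (subst x y φ) := by
  rw [subst_eq_rename]
  intro h
  obtain ⟨z, -, hz⟩ := fv_rename_subset _ _ h
  rcases eq_or_ne z x with rfl | hzx
  · exact hxy (by simpa using hz.symm)
  · simp [hzx] at hz

theorem admissible_subst_cancel (hy : y ∉ fv φ) (hb : y ∉ bv φ) :
    Admissible y x (subst x y φ) := by
  induction φ with
  | atom => trivial
  | neg _ ih | K _ ih => exact ih hy hb
  | and _ _ ih₁ ih₂ =>
    exact ⟨ih₁ (fun h => hy (.inl h)) fun h => hb (.inl h),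
      ih₂ (fun h => hy (.inr h)) fun h => hb (.inr h)⟩
  | wh z _ ih =>
    rcases eq_or_ne z x with rfl | hz
    · simp only [subst, if_true]
      exact .inl hy
    · simp only [subst, hz, if_false]
      exact .inr ⟨hz, ih (fun h => hy ⟨h, fun e => hb (.inl e)⟩) fun h => hb (.inr h)⟩

end Renaming

section Soundness

variable {Var Pred : Type u} {ar : Pred → ℕ} [DecidableEq Var]

theorem Model.sat_congr (M : Model Pred ar) (o : WhOp) {φ : Form Var Pred ar} {w : M.W}
    {σ τ : Var → M.D} (h : ∀ z ∈ fv φ, σ z = τ z) : M.Sat o φ w σ ↔ M.Sat o φ w τ := by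
  induction φ generalizing w σ τ with
  | atom p ys =>
    have : (fun i => σ (ys i)) = fun i => τ (ys i) := funext fun i => h _ ⟨i, rfl⟩
    simp only [Sat, this]
  | neg _ ih | K _ ih => simp only [Sat, ih h]
  | and _ _ ih₁ ih₂ =>
    simp only [Sat, ih₁ fun z hz => h z (.inl hz), ih₂ fun z hz => h z (.inr hz)]
  | wh x φ ih =>
    have : ∀ a v, M.Sat o φ v (Function.update σ x a) ↔ M.Sat o φ v (Function.update τ x a) := by
      refine fun a v => ih fun z hz => ?_
      rcases eq_or_ne z x with rfl | hzx
      · simp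
      · simpa [hzx] using h z ⟨hz, hzx⟩
    simp only [Sat, this]

theorem Model.sat_update_of_notMem_fv (M : Model Pred ar) (o : WhOp) {φ : Form Var Pred ar}
    {x : Var} (hx : x ∉ fv φ) (w : M.W) (σ : Var → M.D) (a : M.D) :
    M.Sat o φ w (Function.update σ x a) ↔ M.Sat o φ w σ :=
  M.sat_congr o fun _ hz => Function.update_of_ne (ne_of_mem_of_not_mem hz hx) _ _

theorem Model.sat_subst (M : Model Pred ar) (o : WhOp) {x y : Var} {φ : Form Var Pred ar}
    (h : Admissible x y φ) (w : M.W) (σ : Var → M.D) :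
    M.Sat o (subst x y φ) w σ ↔ M.Sat o φ w (Function.update σ x (σ y)) := by
  induction φ generalizing w σ with
  | atom p ys =>
    have : (fun i => σ (if ys i = x then y else ys i)) =
        fun i => Function.update σ x (σ y) (ys i) := by
      funext i
      by_cases hi : ys i = x <;> simp [hi]
    simp only [subst, Sat, this]
  | neg _ ih | K _ ih => simp only [subst, Sat, ih h]
  | and _ _ ih₁ ih₂ => simp only [subst, Sat, ih₁ h.1, ih₂ h.2]
  | wh z φ ih =>
    by_cases hx : x ∈ fv (wh z φ)
    · have hzx : z ≠ x := fun e => hx.2 e.symm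
      obtain ⟨hzy, hφ⟩ := h.resolve_left (not_not.2 hx)
      have : ∀ a v, M.Sat o (subst x y φ) v (Function.update σ z a) ↔
          M.Sat o φ v (Function.update (Function.update σ x (σ y)) z a) := by
        intro a v
        rw [ih hφ, Function.update_of_ne hzy.symm, Function.update_comm hzx.symm]
      simp only [subst, hzx, if_false, Sat, this]
    · rw [subst_of_notMem_fv hx, M.sat_update_of_notMem_fv o hx]

@[simp]
theorem Model.sat_imp (M : Model Pred ar) (o : WhOp) (φ ψ : Form Var Pred ar) (w : M.W)
    (σ : Var → M.D) : M.Sat o (imp φ ψ) w σ ↔ (M.Sat o φ w σ → M.Sat o ψ w σ) := by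
  simp [imp, Sat]

theorem Model.sat_iff_peval (M : Model Pred ar) (o : WhOp) (φ : Form Var Pred ar) (w : M.W)
    (σ : Var → M.D) : M.Sat o φ w σ ↔ peval (fun χ => M.Sat o χ w σ) φ := by
  induction φ with
  | neg _ ih => simp only [Sat, peval, ih]
  | and _ _ ih₁ ih₂ => simp only [Sat, peval, ih₁, ih₂]
  | _ => rfl

theorem bHolds_iff_kHolds {W : Type u} {R : W → W → Prop} (hR : Equivalence R) (w : W)
    (S : W → Prop) : BHolds R w S ↔ KHolds R w S :=
  ⟨fun ⟨_, hv, h⟩ u hu => h u (hR.trans (hR.symm hv) hu), fun h => ⟨w, hR.refl w, h⟩⟩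

theorem Model.sat_B (M : Model Pred ar) (hR : Equivalence M.R) (o : WhOp) (φ : Form Var Pred ar)
    (w : M.W) (σ : Var → M.D) : M.Sat o (B φ) w σ ↔ M.Sat o (K φ) w σ := by
  refine Iff.trans ?_ (bHolds_iff_kHolds hR w fun v => M.Sat o φ v σ)
  simp [B, dia, Sat, KHolds, BHolds]

theorem Model.sat_chain (M : Model Pred ar) (o : WhOp) {x : Var} {χ χ' : Form Var Pred ar}
    {σ : Var → M.D}
    (hχ : ∀ w, (∀ a, M.Sat o χ w (Function.update σ x a)) → M.Sat o χ' w σ)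
    {l : List (Form Var Pred ar)} {ψ : Form Var Pred ar} (hx : ∀ θ ∈ ψ :: l, x ∉ fv θ) {w : M.W}
    (h : ∀ a, M.Sat o (chain ψ l χ) w (Function.update σ x a)) :
    M.Sat o (chain ψ l χ') w σ := by
  have hψ : ∀ a w, M.Sat o ψ w (Function.update σ x a) ↔ M.Sat o ψ w σ :=
    fun a w => M.sat_update_of_notMem_fv o (hx ψ (by simp)) w σ a
  induction l generalizing ψ w with
  | nil =>
    simp only [chain, sat_imp, hψ] at h ⊢
    exact fun h' => hχ w fun a => h a h'
  | cons ψ' l ih =>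
    simp only [chain, sat_imp, hψ] at h ⊢
    intro h' v hv
    exact ih (fun θ hθ => hx θ (List.mem_cons_of_mem _ hθ)) (fun a => h a h' v hv)
      fun a w => M.sat_update_of_notMem_fv o (hx ψ' (by simp)) w σ a

section Axioms

variable (M : Model Pred ar) {χ : Form Var Pred ar}

theorem Model.sat_wh_of_sat_K_subst {x y : Var} {φ : Form Var Pred ar} (hxy : Admissible x y φ)
    {w : M.W} {σ : Var → M.D} (h : M.Sat .KMS (K (subst x y φ)) w σ) :
    M.Sat .KMS (wh x φ) w σ :=
  ⟨σ y, fun v hv => (M.sat_subst .KMS hxy v σ).1 (h v hv)⟩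

theorem Model.sat_of_mem_axS42 (hR : Equivalence M.R) (o : WhOp) (h : χ ∈ axS42) (w : M.W)
    (σ : Var → M.D) : M.Sat o χ w σ := by
  rcases h with ((⟨φ, ψ, rfl⟩ | ⟨φ, rfl⟩) | ⟨φ, rfl⟩) | ⟨φ, rfl⟩ <;> simp only [sat_imp]
  · exact fun h₁ h₂ v hv => (M.sat_imp o φ ψ v σ).1 (h₁ v hv) (h₂ v hv)
  · exact fun h => h w (hR.refl w)
  · exact fun h v hv u hu => h u (hR.trans hv hu)
  · intro h v hv hn
    exact hn v (hR.refl v) ((M.sat_B hR o φ w σ).1 h v hv)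

theorem Model.sat_of_mem_TBtoKwh (hR : Equivalence M.R) (h : χ ∈ TBtoKwh) (w : M.W)
    (σ : Var → M.D) : M.Sat .KMS χ w σ := by
  obtain ⟨x, y, φ, hxy, rfl⟩ := h
  rw [sat_imp]
  exact fun h => M.sat_wh_of_sat_K_subst hxy ((M.sat_B hR .KMS (subst x y φ) w σ).1 h.1)

theorem Model.sat_of_mem_KtoKwh (h : χ ∈ KtoKwh) (w : M.W) (σ : Var → M.D) :
    M.Sat .KMS χ w σ := by
  obtain ⟨x, y, φ, hxy, rfl⟩ := h
  rw [sat_imp]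
  exact M.sat_wh_of_sat_K_subst hxy

theorem Model.sat_of_mem_KwhtoFS (hR : Equivalence M.R) (o : WhOp) (h : χ ∈ KwhtoFS) (w : M.W)
    (σ : Var → M.D) : M.Sat o χ w σ := by
  obtain ⟨x, y, φ, -, rfl⟩ := h
  change M.Sat o (imp (wh x φ) (imp (B (subst x y φ)) (subst x y φ))) w σ
  rw [sat_imp, sat_imp, M.sat_B hR]
  exact fun _ h => h w (hR.refl w)

theorem Model.sat_of_mem_BtoBKwh (hR : Equivalence M.R) (h : χ ∈ BtoBKwh) (w : M.W)
    (σ : Var → M.D) : M.Sat .KMS χ w σ := by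
  obtain ⟨x, y, φ, hxy, rfl⟩ := h
  rw [sat_imp, M.sat_B hR, M.sat_B hR]
  exact fun h v hv => M.sat_wh_of_sat_K_subst hxy fun u hu => h u (hR.trans hv hu)

end Axioms

section Rules

variable (M : Model Pred ar) {α β : Form Var Pred ar}

theorem Model.sat_of_KwhtoTB (hR : Equivalence M.R) (r : KwhtoTB α β)
    (h : ∀ w σ, M.Sat .KMS α w σ) (w : M.W) (σ : Var → M.D) : M.Sat .KMS β w σ := by
  obtain ⟨ψ, l, x, φ, hx, rfl, rfl⟩ := r
  refine M.sat_chain .KMS (fun v hv => ?_) hx fun a => h w _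
  rintro ⟨a, ha⟩
  exact hv a ⟨(M.sat_B hR _ _ _ _).2 ha, ha v (hR.refl v)⟩

theorem Model.sat_of_KwhtoK (r : KwhtoK α β) (h : ∀ w σ, M.Sat .KMS α w σ) (w : M.W)
    (σ : Var → M.D) : M.Sat .KMS β w σ := by
  obtain ⟨ψ, l, x, φ, hx, rfl, rfl⟩ := r
  refine M.sat_chain .KMS (fun v hv => ?_) hx fun a => h w _
  rintro ⟨a, ha⟩
  exact hv a ha

theorem Model.sat_of_FSBtoKwh (hR : Equivalence M.R) (r : FSBtoKwh α β)
    (h : ∀ w σ, M.Sat .KMS α w σ) (w : M.W) (σ : Var → M.D) : M.Sat .KMS β w σ := by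
  obtain ⟨ψ, l, x, y, φ, hx, hxy, rfl, rfl⟩ := r
  refine M.sat_chain .KMS (fun v _ => ?_) hx fun a => h w _
  rw [sat_imp, M.sat_B hR]
  exact M.sat_wh_of_sat_K_subst hxy

theorem Model.sat_of_FSKtoKwh (r : FSKtoKwh α β) (h : ∀ w σ, M.Sat .KMS α w σ) (w : M.W)
    (σ : Var → M.D) : M.Sat .KMS β w σ := by
  obtain ⟨ψ, l, x, y, φ, hx, hxy, rfl, rfl⟩ := r
  refine M.sat_chain .KMS (fun v _ => ?_) hx fun a => h w _
  rw [sat_imp]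
  exact M.sat_wh_of_sat_K_subst hxy

end Rules

theorem S42Wh_subset_validS5 (o : WhOp) :
    S42Wh Var Pred ar o ⊆ {φ | ValidS5 .KMS φ} := by
  intro φ h M hR
  induction h with
  | taut t => exact fun w σ => (M.sat_iff_peval _ _ _ _).2 (t _)
  | ax h =>
    rcases h with h | h
    · exact M.sat_of_mem_axS42 hR .KMS h
    · cases o with
      | tBMS => exact M.sat_of_mem_TBtoKwh hR h
      | KMS => exact M.sat_of_mem_KtoKwh h
      | tBMSFS | KMSFS =>
        exact h.elim (M.sat_of_mem_KwhtoFS hR .KMS) (M.sat_of_mem_BtoBKwh hR)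
  | mp _ _ ih₁ ih₂ => exact fun w σ => (M.sat_imp _ _ _ _ _).1 (ih₁ w σ) (ih₂ w σ)
  | nec _ ih => exact fun _ σ v _ => ih v σ
  | rule r _ ih =>
    cases o with
    | tBMS => exact M.sat_of_KwhtoTB hR r ih
    | tBMSFS => exact r.elim (M.sat_of_KwhtoTB hR · ih) (M.sat_of_FSBtoKwh hR · ih)
    | KMS => exact M.sat_of_KwhtoK r ih
    | KMSFS => exact r.elim (M.sat_of_KwhtoK · ih) (M.sat_of_FSKtoKwh · ih)

theorem believed_subset_validS5 (o : WhOp) :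
    believed (S42Wh Var Pred ar o) ⊆ {φ | ValidS5 .KMS φ} := fun φ h M hR w σ =>
  (M.sat_B hR .KMS φ w σ).1 (S42Wh_subset_validS5 o h M hR w σ) w (hR.refl w)

end Soundness

section S5

open Derivable

variable {Var Pred : Type u} {ar : Pred → ℕ} {X : Set (Form Var Pred ar)}

theorem axDist_subset_axS5_union : axDist ⊆ axS5 ∪ X := fun _ h => .inl (.inl (.inl (.inl h)))

theorem axT_subset_axS5_union : axT ⊆ axS5 ∪ X := fun _ h => .inl (.inl (.inl (.inr h)))

theorem axFour_subset_axS5_union : axFour ⊆ axS5 ∪ X := fun _ h => .inl (.inl (.inr h))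

theorem axFive_subset_axS5_union : axFive ⊆ axS5 ∪ X := fun _ h => .inl (.inr h)

/-- `∀x [K]φ`, which is expressible as `¬[K_wh]^x ¬[K]φ` under the mention-some reading because
every formula `¬[K]φ` is equivalent to `[K]¬[K]φ`. -/
def allK (x : Var) (φ : Form Var Pred ar) : Form Var Pred ar := neg (wh x (neg (K φ)))

variable [DecidableEq Var]

/-- Theoremhood in `S5Wh`. -/
abbrev S5Thm (φ : Form Var Pred ar) : Prop := Derivable (axS5 ∪ KtoKwh) KwhtoKZero φ

variable {x y : Var} {φ ψ : Form Var Pred ar}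

namespace S5Thm

theorem wh_intro (hxy : Admissible x y φ) : S5Thm (imp (K (subst x y φ)) (wh x φ)) :=
  ax (.inr ⟨x, y, φ, hxy, rfl⟩)

theorem wh_intro_self (x : Var) (φ : Form Var Pred ar) : S5Thm (imp (K φ) (wh x φ)) := by
  simpa only [subst_self] using wh_intro (admissible_self x φ)

theorem wh_elim (hx : x ∉ fv ψ) (h : S5Thm (imp (K φ) ψ)) : S5Thm (imp (wh x φ) ψ) :=
  rule ⟨x, φ, ψ, hx, rfl, rfl⟩ h

theorem neg_K_imp_K_neg_K (φ : Form Var Pred ar) : S5Thm (imp (neg (K φ)) (K (neg (K φ)))) :=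
  ax (axFive_subset_axS5_union ⟨φ, rfl⟩)

theorem wh_imp_K_wh (x : Var) (φ : Form Var Pred ar) : S5Thm (imp (wh x φ) (K (wh x φ))) :=
  wh_elim (fun h => h.2 rfl)
    ((K_imp_KK axFour_subset_axS5_union φ).trans
      (K_mono axDist_subset_axS5_union (wh_intro_self x φ)))

theorem wh_imp_wh_subst (hy : y ∉ fv φ) (hb : y ∉ bv φ) :
    S5Thm (imp (wh x φ) (wh y (subst x y φ))) := by
  refine wh_elim (fun hx => notMem_fv_subst hx.2 φ hx.1) ?_
  simpa only [subst_subst_cancel hy hb] using wh_intro (admissible_subst_cancel hy hb)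

theorem of_allK (h : S5Thm (allK x φ)) : S5Thm φ := by
  have hK : S5Thm (K φ) :=
    conseq₃ h (wh_intro_self x (neg (K φ))) (neg_K_imp_K_neg_K φ)
      fun v => by grind [peval_imp, peval_neg, allK]
  exact mp (K_imp_self axT_subset_axS5_union φ) hK

theorem neg_of_neg_and_witness {c : Form Var Pred ar} (hc : y ∉ fv c) (hy : y ∉ fv φ)
    (hb : y ∉ bv φ) (h : S5Thm (neg (and c (imp (wh x φ) (K (subst x y φ)))))) :
    S5Thm (neg c) := by
  have hK : S5Thm (imp (K (subst x y φ)) (neg c)) :=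
    h.conseq fun v => by grind [peval_imp, peval_neg, peval_and]
  have hwh : S5Thm (imp (wh y (subst x y φ)) (neg c)) := wh_elim hc hK
  exact conseq₃ h hwh (wh_imp_wh_subst (x := x) hy hb)
    fun v => by grind [peval_imp, peval_neg, peval_and]

end S5Thm

/-- Maximal consistent sets of the logic `S5Wh`. -/
structure IsS5World (Γ : Set (Form Var Pred ar)) : Prop extends IsMaxCons Γ where
  thm_mem : ∀ {φ}, S5Thm φ → φ ∈ Γ

/-- The two sets contain the same formulas `[K]χ`; this is accessibility in the canonical model. -/
def SameKnowledge (Γ Δ : Set (Form Var Pred ar)) : Prop := ∀ χ, K χ ∈ Γ ↔ K χ ∈ Δ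

variable {Γ Δ : Set (Form Var Pred ar)}

theorem IsS5World.mem_of_imp (hΓ : IsS5World Γ) (h : S5Thm (imp φ ψ)) (hφ : φ ∈ Γ) : ψ ∈ Γ :=
  hΓ.mp_mem (hΓ.thm_mem h) hφ

theorem IsS5World.isTheory_setOf_K_mem (hΓ : IsS5World Γ) : IsTheory {φ | K φ ∈ Γ} where
  taut_mem t := hΓ.thm_mem (nec (taut t))
  mp_mem h₁ h₂ := hΓ.mp_mem (hΓ.mem_of_imp (dist axDist_subset_axS5_union _ _) h₁) h₂

theorem IsS5World.exists_sameKnowledge_notMem (hΓ : IsS5World Γ) (hψ : K ψ ∉ Γ) :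
    ∃ Δ, IsS5World Δ ∧ SameKnowledge Γ Δ ∧ ψ ∉ Δ := by
  obtain ⟨Δ, hΔ, hle, hψΔ⟩ := hΓ.isTheory_setOf_K_mem.exists_isMaxCons hψ
  refine ⟨Δ, ⟨hΔ, fun h => hle (hΓ.thm_mem (nec h))⟩, fun χ => ⟨fun h => ?_, fun h => ?_⟩, hψΔ⟩
  · exact hle (hΓ.mem_of_imp (K_imp_KK axFour_subset_axS5_union χ) h)
  · by_contra hχ
    have hneg : neg (K χ) ∈ Δ :=
      hle (hΓ.mem_of_imp (.neg_K_imp_K_neg_K χ) (hΓ.neg_mem_iff.2 hχ))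
    exact hΔ.neg_mem_iff.1 hneg h

theorem IsS5World.wh_mem_of_sameKnowledge (hΓ : IsS5World Γ) (hΔ : IsS5World Δ)
    (hK : SameKnowledge Γ Δ) (h : wh x φ ∈ Γ) : wh x φ ∈ Δ :=
  hΔ.mem_of_imp (K_imp_self axT_subset_axS5_union _)
    ((hK _).1 (hΓ.mem_of_imp (.wh_imp_K_wh x φ) h))

end S5

section Witnesses

open Derivable

variable {Var Pred : Type u} {ar : Pred → ℕ}

/-- Every formula `[K_wh]^x θ` of `S` that belongs to `Γ` has a witness in `D`. -/
def HasWitnesses [DecidableEq Var] (D : Set Var) (S Γ : Set (Form Var Pred ar)) : Prop :=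
  ∀ x θ, wh x θ ∈ S → wh x θ ∈ Γ → ∃ y ∈ D, K (subst x y θ) ∈ Γ

variable [DecidableEq Var] (Var Pred ar)

/-- The consistent formulas of `S5Wh`, preordered with the stronger ones larger: forcing conditions
for the construction of a maximal consistent set with witnesses. -/
def ConsistentForm : Type u := {c : Form Var Pred ar // ¬ S5Thm (neg c)}

variable {Var Pred ar}

instance : Preorder (ConsistentForm Var Pred ar) where
  le c d := S5Thm (imp d.1 c.1)
  le_refl _ := taut fun v => by grind [peval_imp]
  le_trans _ _ _ hcd hde := hde.trans hcd

variable {D : Set Var} {S Γ Δ : Set (Form Var Pred ar)}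

theorem HasWitnesses.of_sameKnowledge (h : HasWitnesses D S Γ) (hΓ : IsS5World Γ)
    (hΔ : IsS5World Δ) (hK : SameKnowledge Γ Δ) : HasWitnesses D S Δ := by
  intro x θ hS hwh
  obtain ⟨y, hy, hθ⟩ := h x θ hS (hΔ.wh_mem_of_sameKnowledge hΓ (fun χ => (hK χ).symm) hwh)
  exact ⟨y, hy, (hK _).1 hθ⟩

theorem isCofinal_setOf_imp_witness (hD : D.Infinite) (x : Var) (θ : Form Var Pred ar) :
    IsCofinal {c : ConsistentForm Var Pred ar |
      ∃ y ∈ D, S5Thm (imp c.1 (imp (wh x θ) (K (subst x y θ))))} := by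
  intro c
  obtain ⟨y, hyD, hy⟩ := hD.exists_notMem_finite
    (((finite_fv c.1).union (finite_fv θ)).union (finite_bv θ))
  simp only [Set.mem_union, not_or] at hy
  exact ⟨⟨and c.1 (imp (wh x θ) (K (subst x y θ))),
      fun h => c.2 (S5Thm.neg_of_neg_and_witness hy.1.1 hy.1.2 hy.2 h)⟩,
    ⟨y, hyD, taut fun v => by grind [peval_imp, peval_and]⟩,
      taut fun v => by grind [peval_imp, peval_and]⟩

theorem isTheory_setOf_exists_mem_ideal (I : Order.Ideal (ConsistentForm Var Pred ar)) :
    IsTheory {ψ | ∃ c ∈ I, S5Thm (imp c.1 ψ)} where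
  taut_mem t := by
    obtain ⟨c, hc⟩ := I.nonempty
    exact ⟨c, hc, (taut t).conseq fun v => by grind [peval_imp]⟩
  mp_mem := by
    rintro φ ψ ⟨c, hc, hφψ⟩ ⟨d, hd, hφ⟩
    obtain ⟨e, he, hce, hde⟩ := I.directed c hc d hd
    exact ⟨e, he, conseq₂ (trans hce hφψ) (trans hde hφ) fun v => by grind [peval_imp]⟩

theorem exists_isS5World_hasWitnesses (hD : D.Infinite) (hS : S.Countable)
    {φ : Form Var Pred ar} (hφ : ¬ S5Thm φ) :
    ∃ Γ, IsS5World Γ ∧ φ ∉ Γ ∧ HasWitnesses D S Γ := by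
  let c₀ : ConsistentForm Var Pred ar :=
    ⟨neg φ, fun h => hφ (h.conseq fun v => by grind [peval_imp, peval_neg])⟩
  let WhPair := {p : Var × Form Var Pred ar // wh p.1 p.2 ∈ S}
  have : Countable S := hS.to_subtype
  have : Countable WhPair := by
    refine Function.Injective.countable (f := fun p : WhPair => (⟨_, p.2⟩ : S)) ?_
    rintro ⟨⟨x, θ⟩, _⟩ ⟨⟨y, χ⟩, _⟩ h
    obtain ⟨rfl, rfl⟩ := Form.wh.inj (Subtype.ext_iff.1 h)
    rfl
  have := Encodable.ofCountable WhPair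
  let 𝒟 (p : WhPair) : Order.Cofinal (ConsistentForm Var Pred ar) :=
    ⟨_, isCofinal_setOf_imp_witness hD p.1.1 p.1.2⟩
  let I := Order.idealOfCofinals c₀ 𝒟
  have hφI : φ ∉ {ψ | ∃ c ∈ I, S5Thm (imp c.1 ψ)} := by
    rintro ⟨c, hc, hcφ⟩
    obtain ⟨d, -, hcd, hd⟩ := I.directed c hc c₀ (Order.mem_idealOfCofinals c₀ 𝒟)
    exact d.2 (conseq₂ (trans hcd hcφ) hd fun v => by grind [peval_imp, peval_neg])
  obtain ⟨Γ, hΓ, hIΓ, hφΓ⟩ := (isTheory_setOf_exists_mem_ideal I).exists_isMaxCons hφI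
  refine ⟨Γ, ⟨hΓ, fun {ψ} h => hIΓ ?_⟩, hφΓ, fun x θ hxθ hwh => ?_⟩
  · exact ⟨c₀, Order.mem_idealOfCofinals c₀ 𝒟, h.conseq fun v => by grind [peval_imp]⟩
  · obtain ⟨c, ⟨y, hy, hcy⟩, hc⟩ := Order.cofinal_meets_idealOfCofinals c₀ 𝒟 ⟨(x, θ), hxθ⟩
    exact ⟨y, hy, hΓ.mp_mem (hIΓ ⟨c, hc, hcy⟩) hwh⟩

end Witnesses

section Completeness

variable {Var Pred : Type u} {ar : Pred → ℕ} [DecidableEq Var]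

/-- The instances of the subformulas `[K_wh]^x θ` of a formula in which individuals from `D` are
put for the free variables. -/
def whInstances (D : Set Var) : Form Var Pred ar → Set (Form Var Pred ar)
  | .atom _ _ => ∅
  | .neg φ => whInstances D φ
  | .and φ ψ => whInstances D φ ∪ whInstances D ψ
  | .K φ => whInstances D φ
  | .wh x φ => whInstances D φ ∪ Set.range fun σ : Var → D => rename (Subtype.val ∘ σ) (.wh x φ)

theorem countable_range_rename {D : Set Var} (hD : D.Countable) (φ : Form Var Pred ar) :
    (Set.range fun σ : Var → D => rename (Subtype.val ∘ σ) φ).Countable := by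
  classical
  have := hD.to_subtype
  have := (finite_fv φ).to_subtype
  refine (Set.countable_range fun f : fv φ → D =>
    rename (fun z => if hz : z ∈ fv φ then (f ⟨z, hz⟩ : Var) else z) φ).mono ?_
  rintro _ ⟨σ, rfl⟩
  exact ⟨fun z => σ z, rename_congr fun z hz => by simp [hz]⟩

theorem countable_whInstances {D : Set Var} (hD : D.Countable) (φ : Form Var Pred ar) :
    (whInstances D φ).Countable := by
  induction φ with
  | atom => exact Set.countable_empty
  | neg _ ih | K _ ih => exact ih
  | and _ _ ih₁ ih₂ => exact ih₁.union ih₂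
  | wh x φ ih => exact ih.union (countable_range_rename hD (wh x φ))

section CanonicalModel

variable {Γ : Set (Form Var Pred ar)} (hΓ : IsS5World Γ) {D : Set Var} (hD : D.Nonempty)

/-- The model whose worlds are the maximal consistent sets with the same knowledge as `Γ`, all
accessible from each other, and whose individuals are the variables in `D`. -/
def canonicalModel : Model Pred ar where
  W := {Δ : Set (Form Var Pred ar) // IsS5World Δ ∧ SameKnowledge Γ Δ}
  D := D
  nonempty_W := ⟨⟨Γ, hΓ, fun _ => Iff.rfl⟩⟩
  nonempty_D := hD.to_subtype
  R _ _ := True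
  ρ p w := {a | atom p (Subtype.val ∘ a) ∈ w.1}

variable {hΓ hD} {φ : Form Var Pred ar} {x : Var}

theorem canonicalModel.K_mem_iff (w : (canonicalModel hΓ hD).W) :
    K φ ∈ w.1 ↔ ∀ v : (canonicalModel hΓ hD).W, φ ∈ v.1 := by
  refine ⟨fun h v => ?_, fun h => ?_⟩
  · exact v.2.1.mem_of_imp (Derivable.K_imp_self axT_subset_axS5_union φ)
      ((v.2.2 φ).1 ((w.2.2 φ).2 h))
  · by_contra hφ
    obtain ⟨Δ, hΔ, hK, hφΔ⟩ := hΓ.exists_sameKnowledge_notMem fun h => hφ ((w.2.2 φ).1 h)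
    exact hφΔ (h ⟨Δ, hΔ, hK⟩)

theorem canonicalModel.sat_wh_iff_rename_mem (hbv : ∀ z ∈ bv (wh x φ), z ∉ D)
    (w : (canonicalModel hΓ hD).W) (σ : Var → D)
    (hwit : HasWitnesses D {rename (Subtype.val ∘ σ) (wh x φ)} Γ)
    (ih : ∀ (v : (canonicalModel hΓ hD).W) (τ : Var → D),
      (canonicalModel hΓ hD).Sat .KMS φ v τ ↔ rename (Subtype.val ∘ τ) φ ∈ v.1) :
    (canonicalModel hΓ hD).Sat .KMS (wh x φ) w σ ↔ rename (Subtype.val ∘ σ) (wh x φ) ∈ w.1 := by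
  set θ := rename (Function.update (Subtype.val ∘ σ) x x) φ with hθ
  have rename_update (a : D) : rename (Subtype.val ∘ Function.update σ x a) φ = subst x a θ := by
    rw [Function.comp_update, hθ, subst_rename_update]
    · exact fun z _ _ h => hbv x (.inl rfl) (h ▸ (σ z).2)
    · exact fun z _ h => hbv _ (.inr h) (σ z).2
  have kHolds_iff (a : D) : KHolds (canonicalModel hΓ hD).R w (fun v =>
      (canonicalModel hΓ hD).Sat .KMS φ v (Function.update σ x a)) ↔ K (subst x a θ) ∈ w.1 := by
    simp only [K_mem_iff, ← rename_update, ← ih]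
    exact ⟨fun h v => h v trivial, fun h v _ => h v⟩
  refine (exists_congr kHolds_iff).trans ⟨fun ⟨a, ha⟩ => ?_, fun h => ?_⟩
  · have haθ : (a : Var) ∉ bv θ := fun h => hbv a (.inr (bv_rename _ φ ▸ h)) a.2
    exact w.2.1.mem_of_imp (.wh_intro (admissible_of_notMem_bv haθ)) ha
  · obtain ⟨a, haD, ha⟩ := hwit.of_sameKnowledge hΓ w.2.1 w.2.2 x θ rfl h
    exact ⟨⟨a, haD⟩, ha⟩

theorem canonicalModel.sat_iff_rename_mem (hbv : ∀ z ∈ bv φ, z ∉ D)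
    (hwit : HasWitnesses D (whInstances D φ) Γ) (w : (canonicalModel hΓ hD).W) (σ : Var → D) :
    (canonicalModel hΓ hD).Sat .KMS φ w σ ↔ rename (Subtype.val ∘ σ) φ ∈ w.1 := by
  induction φ generalizing w σ with
  | atom => rfl
  | neg _ ih => simp only [Model.Sat, rename, ih hbv hwit w σ, w.2.1.neg_mem_iff]
  | and _ _ ih₁ ih₂ =>
    have h₁ := ih₁ (fun z h => hbv z (.inl h)) (fun x θ h => hwit x θ (.inl h)) w σ
    have h₂ := ih₂ (fun z h => hbv z (.inr h)) (fun x θ h => hwit x θ (.inr h)) w σ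
    simp only [Model.Sat, rename, h₁, h₂, w.2.1.and_mem_iff]
  | K _ ih =>
    simp only [Model.Sat, rename, K_mem_iff, KHolds, ih hbv hwit]
    exact ⟨fun h v => h v trivial, fun h v _ => h v⟩
  | wh x φ ih =>
    refine sat_wh_iff_rename_mem hbv w σ (fun y θ h => hwit y θ (.inr ⟨σ, h.symm⟩)) ?_
    exact ih (fun z h => hbv z (.inr h)) fun y θ h => hwit y θ (.inl h)

end CanonicalModel

variable {φ : Form Var Pred ar}

theorem ValidS5.allK (x : Var) (h : ValidS5 .KMS φ) : ValidS5 .KMS (allK x φ) := by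
  rintro M hR w σ ⟨a, ha⟩
  exact ha w (hR.refl w) fun v _ => h M hR v _

variable [Infinite Var]

theorem S5Thm.of_validS5_of_fv_eq_empty (hφ : fv φ = ∅) (h : ValidS5 .KMS φ) : S5Thm φ := by
  by_contra hn
  obtain ⟨D, hDbv, hDc, hD⟩ :=
    (finite_bv φ).infinite_compl.exists_subset_countable_infinite
  obtain ⟨Γ, hΓ, hφΓ, hwit⟩ := exists_isS5World_hasWitnesses hD (countable_whInstances hDc φ) hn
  obtain ⟨d, hd⟩ := hD.nonempty
  let M := canonicalModel hΓ ⟨d, hd⟩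
  have hM : Equivalence M.R := ⟨fun _ => trivial, fun _ => trivial, fun _ _ => trivial⟩
  let w : M.W := ⟨Γ, hΓ, fun _ => Iff.rfl⟩
  let σ : Var → D := fun _ => ⟨d, hd⟩
  have hmem : rename (Subtype.val ∘ σ) φ ∈ Γ :=
    (canonicalModel.sat_iff_rename_mem (fun z hz hzD => hDbv hzD hz) hwit w σ).1 (h M hM w σ)
  rw [rename_eq_self (by simp [hφ])] at hmem
  exact hφΓ hmem

theorem S5Thm.of_validS5 (h : ValidS5 .KMS φ) : S5Thm φ := by
  induction hn : (fv φ).ncard generalizing φ with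
  | zero => exact of_validS5_of_fv_eq_empty ((Set.ncard_eq_zero (finite_fv φ)).1 hn) h
  | succ n ih =>
    obtain ⟨x, hx⟩ : (fv φ).Nonempty := Set.nonempty_of_ncard_ne_zero (by lia)
    have hcard : (fv (allK x φ)).ncard = n := by
      rw [← Nat.add_right_cancel_iff (n := 1), ← hn]
      exact Set.ncard_sdiff_singleton_add_one hx (finite_fv φ)
    exact of_allK (ih (h.allK x) hcard)

end Completeness

end KnowWh

theorem mainTheorem2 (Var Pred : Type u) (ar : Pred → ℕ) [DecidableEq Var] [Infinite Var]
    (o : KnowWh.WhOp) :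
    KnowWh.believed (KnowWh.S42Wh Var Pred ar o) = KnowWh.S5Wh Var Pred ar ∧
    KnowWh.believed (KnowWh.S42Wh Var Pred ar o) = {φ | KnowWh.ValidS5 KnowWh.WhOp.KMS φ} := by
  have h₁ := KnowWh.S5Wh_subset_believed (Var := Var) (Pred := Pred) (ar := ar) o
  have h₂ := KnowWh.believed_subset_validS5 (Var := Var) (Pred := Pred) (ar := ar) o
  have h₃ : {φ | KnowWh.ValidS5 KnowWh.WhOp.KMS φ} ⊆ KnowWh.S5Wh Var Pred ar :=
    fun _ h => KnowWh.S5Thm.of_validS5 h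
  exact ⟨(h₂.trans h₃).antisymm h₁, h₂.antisymm (h₃.trans h₁)⟩
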